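/- Vectors are compared componentwise: $x\preceq y$ means $x_j\le y_j$ for all $j$, and $x\prec y$ means $x_j<y_j$ for all $j$; $|\cdot|$, $\max$ and $\lim$ of vectors and matrices are taken entrywise; $\mathbb R^n_{+0}$ and $\mathbb R^n_{+}$ are the sets of $x\succeq 0$ and of $x\succ 0$. For $M\in\mathbb C^{n\times n}$, $\mathcal M(M)\in\mathbb R^{n\times n}$ is the matrix with entries $\operatorname{Re}M_{ii}$ on the diagonal and $|M_{il}|$ off the diagonal. A matrix is Hurwitz if all its eigenvalues have negative real part. A map $f:\mathbb R^n_{+0}\to\mathbb R^m_{+0}$ is called CNI if $0\preceq x_1\preceq x_2$ implies $f(x_1)\preceq f(x_2)$. Let $N\ge 1$ and, for $i=1,\dots,N$, let $A_i\in\mathbb R^{n\times n}$, $H_i\in\mathbb R^{n\times k_i}$, and let $\delta_i:\mathbb R^n_{+0}\to\mathbb R^{k_i}_{+0}$ be continuous and CNI; let $\bar\tau\ge 0$. Consider the switching system $$\dot x(t)=A_{\sigma(t)}x(t)+H_{\sigma(t)}w_{\sigma(t)}(t),\qquad |w_i(t)|\preceq\delta_i(\theta(t))\ \text{ for all } t\ge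 0 \text{ and all } i,\qquad \theta(t)=\max_{t-\bar\tau\le s\le t}|x(s)|,$$ with an arbitrary switching function $\sigma$ with values in $\{1,\dots,N\}$. A trajectory is a function $x$ that is continuous on $[-\bar\tau,\infty)$, locally absolutely continuous on $[0,\infty)$, and satisfies the differential equation for almost every $t\ge 0$, for some $\sigma$ and $w_1,\dots,w_N$ as above. Let $V\in\mathbb C^{n\times n}$ be invertible, let $\Lambda=\max_{i}\mathcal M(V^{-1}A_iV)$, and suppose that $\Lambda$ is Hurwitz. Let $$\psi(x)=\max_{i}\ \max_{|w|\preceq\delta_i(|V|x)}|V^{-1}H_iw|,\qquad x\in\mathbb R^n_{+0},$$ where $w$ ranges over $\mathbb R^{k_i}$, let $\delta:\mathbb R^n_{+0}\to\mathbb R^n_{+0}$ be continuous and CNI with $\delta(x)\succeq\psi(x)$ for all $x\in\mathbb R^n_{+0}$, and put $T_0(x)=-\Lambda^{-1}\delta(x)$. Suppose that there is $\beta\in\mathbb R^n_{+0}$ with $T_0(\beta)\prec\beta$. Then the limit $b=\lim_{m\to\infty}T_0^m(\beta)\succeq 0$ exists, and the following holds. Suppose in addition that for every $\varepsilon\in\mathbb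 R^n_{+}$ there is $\beta_\varepsilon$ with $b\preceq\beta_\varepsilon\preceq b+\varepsilon$ and $T_0(\beta_\varepsilon)\prec\beta_\varepsilon$. Then every trajectory $x$ with $|V^{-1}x(t)|\preceq b$ for all $-\bar\tau\le t\le 0$ satisfies $|V^{-1}x(t)|\preceq b$ for all $t\ge-\bar\tau$. -/

import Mathlib

open Set Filter Topology MeasureTheory
open scoped Matrix

namespace SwitchingSystem

noncomputable section

/-- Componentwise magnitude of the complex vector `V⁻¹ x`, for a real vector `x`. -/
def absCoord {n : ℕ} (V : Matrix (Fin n) (Fin n) ℂ) (x : Fin n → ℝ) : Fin n → ℝ :=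
  fun j => ‖(V⁻¹ *ᵥ (fun l => (x l : ℂ))) j‖

/-- The matrix `|V|` of magnitudes of the entries of `V`. -/
def absMatrix {n : ℕ} (V : Matrix (Fin n) (Fin n) ℂ) : Matrix (Fin n) (Fin n) ℝ :=
  V.map (fun z => ‖z‖)

/-- The Metzler matrix `𝓜(M)`: real parts on the diagonal, magnitudes off the diagonal. -/
def metzlerPart {n : ℕ} (M : Matrix (Fin n) (Fin n) ℂ) : Matrix (Fin n) (Fin n) ℝ :=
  Matrix.of fun i l => if i = l then (M i l).re else ‖M i l‖

/-- `Λ = max_i 𝓜(V⁻¹ A_i V)`, the maximum being taken entrywise. -/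
def Lam {N n : ℕ} (A : Fin N → Matrix (Fin n) (Fin n) ℝ) (V : Matrix (Fin n) (Fin n) ℂ) :
    Matrix (Fin n) (Fin n) ℝ :=
  Matrix.of fun j l => ⨆ i : Fin N, metzlerPart (V⁻¹ * (A i).map Complex.ofReal * V) j l

/-- All (complex) eigenvalues of the real matrix `M` have negative real part. -/
def IsHurwitz {n : ℕ} (M : Matrix (Fin n) (Fin n) ℝ) : Prop :=
  ∀ z ∈ spectrum ℂ (M.map Complex.ofReal), z.re < 0

/-- `f` maps the nonnegative orthant of `ℝⁿ` into that of `ℝᵐ`, and is continuous and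
componentwise monotone there (`0 ⪯ x₁ ⪯ x₂` implies `f x₁ ⪯ f x₂`). Values of `f` off the
nonnegative orthant play no role. -/
structure IsContCNI {n m : ℕ} (f : (Fin n → ℝ) → (Fin m → ℝ)) : Prop where
  mapsTo : MapsTo f (Ici 0) (Ici 0)
  continuousOn : ContinuousOn f (Ici 0)
  monotoneOn : MonotoneOn f (Ici 0)

/-- `ψ(x) = max_i max_{|w_i| ⪯ δ_i(|V| x)} |V⁻¹ H_i w_i|`, the maxima being componentwise. -/
def psi {N n : ℕ} {k : Fin N → ℕ} (H : ∀ i, Matrix (Fin n) (Fin (k i)) ℝ)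
    (δw : ∀ i, (Fin n → ℝ) → (Fin (k i) → ℝ)) (V : Matrix (Fin n) (Fin n) ℂ)
    (x : Fin n → ℝ) : Fin n → ℝ :=
  fun j => ⨆ i : Fin N, sSup ((fun w : Fin (k i) → ℝ => absCoord V (H i *ᵥ w) j) ''
    {w | ∀ l, |w l| ≤ δw i (absMatrix V *ᵥ x) l})

/-- `T_γ(x) = -Λ⁻¹ δ(x) + γ`. -/
def T {n : ℕ} (L : Matrix (Fin n) (Fin n) ℝ) (δ : (Fin n → ℝ) → (Fin n → ℝ))
    (γ x : Fin n → ℝ) : Fin n → ℝ :=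
  -(L⁻¹ *ᵥ δ x) + γ

/-- `θ(t) = max_{t - τ ≤ s ≤ t} |x(s)|`, componentwise. -/
def theta {n : ℕ} (τ : ℝ) (x : ℝ → Fin n → ℝ) (t : ℝ) : Fin n → ℝ :=
  fun j => sSup ((fun s => |x s j|) '' Icc (t - τ) t)

/-- `x` is a trajectory of `ẋ = A_σ x + H_σ w_σ` for the switching function `σ` and the
perturbations `w`, where `|w_i(t)| ⪯ δ_i(θ(t))` for all `t ≥ 0` and all `i`: it is continuous on
`[-τ, ∞)`, absolutely continuous on bounded subintervals of `[0, ∞)`, and satisfies the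
differential equation for almost every `t ≥ 0`. -/
structure IsTrajectory {N n : ℕ} {k : Fin N → ℕ} (A : Fin N → Matrix (Fin n) (Fin n) ℝ)
    (H : ∀ i, Matrix (Fin n) (Fin (k i)) ℝ) (δw : ∀ i, (Fin n → ℝ) → (Fin (k i) → ℝ))
    (τ : ℝ) (σ : ℝ → Fin N) (w : ∀ i, ℝ → Fin (k i) → ℝ) (x : ℝ → Fin n → ℝ) : Prop where
  continuousOn : ContinuousOn x (Ici (-τ))
  absolutelyContinuous : ∀ t, 0 ≤ t → AbsolutelyContinuousOnInterval x 0 t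
  hasDerivAt : ∀ᵐ t ∂(volume.restrict (Ici (0 : ℝ))),
    HasDerivAt x (A (σ t) *ᵥ x t + H (σ t) *ᵥ w (σ t) t) t
  bound : ∀ t, 0 ≤ t → ∀ i l, |w i t l| ≤ δw i (theta τ x t) l

end

end SwitchingSystem

/-!
Since `-Λ⁻¹` is entrywise nonnegative for the Hurwitz Metzler matrix `Λ`, the map `T₀` is monotone
and its iterates decrease from `β` to a fixed point `b`. Let `a ⪰ b` be close to `b` with
`T₀ a ≺ a`, and put `e = -Λ⁻¹ 1 ≻ 0`. For small `r > 0` the point `c = T₀ a + r e` lies between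
`b` and `a` and satisfies `Λ c + δ(c) ⪯ Λ c + δ(a) = -r 1 ≺ 0`. Therefore the flow points strictly
into the box `|V⁻¹ x| ⪯ c` on its boundary, as long as the past lies in the box, so a trajectory
starting inside cannot leave it; letting `a` tend to `b` gives the box of `b` itself.
-/

namespace SwitchingSystem

open Function (IsFixedPt)

section MonotoneIteration

variable {α : Type*} [ConditionallyCompleteLattice α] [TopologicalSpace α]
  [InfConvergenceClass α] [OrderClosedTopology α]

theorem exists_isFixedPt_tendsto_iterate {F : α → α} {p a : α} (hpa : p ≤ a)
    (hmono : MonotoneOn F (Icc p a)) (hcont : ContinuousOn F (Icc p a))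
    (hp : p ≤ F p) (ha : F a ≤ a) :
    ∃ b ∈ Icc p a, IsFixedPt F b ∧ Tendsto (fun m : ℕ => F^[m] a) atTop (𝓝 b) := by
  have hp_mem : p ∈ Icc p a := left_mem_Icc.2 hpa
  have ha_mem : a ∈ Icc p a := right_mem_Icc.2 hpa
  have hmaps : MapsTo F (Icc p a) (Icc p a) := fun x hx =>
    ⟨hp.trans (hmono hp_mem hx hx.1), (hmono hx ha_mem hx.2).trans ha⟩
  let f : Icc p a → Icc p a := hmaps.restrict
  have coe_iterate (m : ℕ) : (f^[m] ⟨a, ha_mem⟩ : α) = F^[m] a := by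
    rw [hmaps.iterate_restrict]
    rfl
  have hf_mono : Monotone f := fun x y hxy => hmono x.2 y.2 hxy
  have hanti : Antitone fun m : ℕ => F^[m] a := fun m m' hm => by
    simpa only [← coe_iterate, Subtype.coe_le_coe] using
      hf_mono.antitone_iterate_of_map_le (x := ⟨a, ha_mem⟩) ha hm
  have hmem (m : ℕ) : F^[m] a ∈ Icc p a := hmaps.iterate m ha_mem
  have hlim := tendsto_atTop_ciInf hanti ⟨p, forall_mem_range.2 fun m => (hmem m).1⟩
  have hb : ⨅ m, F^[m] a ∈ Icc p a := isClosed_Icc.mem_of_tendsto hlim (.of_forall hmem)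
  have hfix : IsFixedPt f ⟨_, hb⟩ :=
    isFixedPt_of_tendsto_iterate (x := ⟨a, ha_mem⟩)
      (tendsto_subtype_rng.2 (by simpa only [coe_iterate] using hlim))
      (hcont.mapsToRestrict hmaps).continuousAt
  exact ⟨_, hb, congrArg Subtype.val hfix, hlim⟩

end MonotoneIteration

section StrongLT

variable {ι : Type*} [Finite ι]

theorem isOpen_setOf_strongLT (c : ι → ℝ) : IsOpen {x : ι → ℝ | StrongLT x c} := by
  have : {x : ι → ℝ | StrongLT x c} = univ.pi fun j => Iio (c j) := by
    ext x
    simp [StrongLT]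
  exact this ▸ isOpen_set_pi finite_univ fun _ _ => isOpen_Iio

theorem exists_pos_add_smul_le {x y : ι → ℝ} (hxy : StrongLT x y) (e : ι → ℝ) :
    ∃ r > (0 : ℝ), x + r • e ≤ y := by
  have hcont : Continuous fun r : ℝ => x + r • e := by fun_prop
  have hev : ∀ᶠ r in 𝓝 (0 : ℝ), StrongLT (x + r • e) y :=
    hcont.continuousAt ((isOpen_setOf_strongLT y).mem_nhds (by simpa using hxy))
  obtain ⟨r, hr, hr0⟩ := ((hev.filter_mono nhdsWithin_le_nhds).and
    (self_mem_nhdsWithin (s := Ioi (0 : ℝ)))).exists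
  exact ⟨r, hr0, hr.le⟩

theorem exists_first_exit {r : ℝ → ι → ℝ} {c : ι → ℝ} {a b : ℝ} (hab : a ≤ b)
    (hr : ContinuousOn r (Icc a b)) (ha : StrongLT (r a) c) (hb : ¬ StrongLT (r b) c) :
    ∃ t ∈ Ioc a b, (∃ j, r t j = c j) ∧ ∀ s ∈ Ico a t, StrongLT (r s) c := by
  let E : Set ℝ := Icc a b ∩ r ⁻¹' {x | StrongLT x c}ᶜ
  have hE : IsClosed E :=
    hr.preimage_isClosed_of_isClosed isClosed_Icc (isOpen_setOf_strongLT c).isClosed_compl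
  have hE_compact : IsCompact E := isCompact_Icc.of_isClosed_subset hE inter_subset_left
  obtain ⟨t, ⟨ht, htc⟩, hmin⟩ := hE_compact.exists_isLeast ⟨b, right_mem_Icc.2 hab, hb⟩
  obtain ⟨j, hj⟩ : ∃ j, c j ≤ r t j := by simpa [StrongLT] using htc
  obtain ⟨s, hs, hsj⟩ : c j ∈ (fun s => r s j) '' Icc a t :=
    intermediate_value_Icc ht.1 ((continuous_apply j).comp_continuousOn
      (hr.mono (Icc_subset_Icc_right ht.2))) ⟨(ha j).le, hj⟩
  have hst : s = t := le_antisymm hs.2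
    (hmin ⟨⟨hs.1, hs.2.trans ht.2⟩, fun h => (h j).ne hsj⟩)
  refine ⟨t, ⟨lt_of_le_of_ne ht.1 ?_, ht.2⟩, ⟨j, hst ▸ hsj⟩, fun u hu => ?_⟩
  · rintro rfl
    exact htc ha
  · by_contra h
    exact hu.2.not_ge (hmin ⟨⟨hu.1, hu.2.le.trans ht.2⟩, h⟩)

end StrongLT

section AbsolutelyContinuous

theorem absolutelyContinuousOnInterval_lipschitz_comp {X Y : Type*} [PseudoMetricSpace X]
    [PseudoMetricSpace Y] {g : X → Y} {K : NNReal} (hg : LipschitzWith K g) {f : ℝ → X} {a b : ℝ}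
    (hf : AbsolutelyContinuousOnInterval f a b) :
    AbsolutelyContinuousOnInterval (g ∘ f) a b := by
  have hK := Tendsto.const_mul (K : ℝ) hf
  rw [mul_zero] at hK
  refine squeeze_zero (fun E => Finset.sum_nonneg fun _ _ => dist_nonneg) (fun E => ?_) hK
  rw [Finset.mul_sum]
  exact Finset.sum_le_sum fun _ _ => hg.dist_le_mul _ _

theorem le_of_ae_hasDerivAt_nonpos {f : ℝ → ℝ} {a b : ℝ} (hab : a ≤ b)
    (hf : AbsolutelyContinuousOnInterval f a b)
    (hderiv : ∀ᵐ t, t ∈ Ioo a b → ∃ f' ≤ 0, HasDerivAt f f' t) : f b ≤ f a := by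
  have hint : ∫ t in a..b, deriv f t = f b - f a := hf.integral_deriv_eq_sub
  rw [intervalIntegral.integral_of_le hab, integral_Ioc_eq_integral_Ioo] at hint
  refine sub_nonpos.1 (hint ▸ integral_nonpos_of_ae ?_)
  rw [EventuallyLE, ae_restrict_iff' measurableSet_Ioo]
  filter_upwards [hderiv] with t ht hmem
  obtain ⟨f', hf'_nonpos, hf'⟩ := ht hmem
  exact hf'.deriv.trans_le hf'_nonpos

end AbsolutelyContinuous

section Metzler

/-- A matrix is Metzler if its off-diagonal entries are nonnegative. -/
def IsMetzler {ι R : Type*} [Zero R] [LE R] (L : Matrix ι ι R) : Prop :=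
  ∀ i j, i ≠ j → 0 ≤ L i j

namespace IsMetzler

theorem sub_smul_one {ι R : Type*} [DecidableEq ι] [Ring R] [LE R] {L : Matrix ι ι R}
    (hL : IsMetzler L) (μ : R) : IsMetzler (L - μ • (1 : Matrix ι ι R)) := fun i j hij => by
  simpa [hij] using hL i j hij

section OrderedRing

variable {ι R : Type*} [Fintype ι] [Ring R] [LinearOrder R] [IsStrictOrderedRing R]
  {L : Matrix ι ι R} {v : ι → R}

theorem diag_mul_le_mulVec (hL : IsMetzler L) (hv : 0 ≤ v) (j : ι) :
    L j j * v j ≤ (L *ᵥ v) j := by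
  classical
  rw [Matrix.mulVec, dotProduct, ← Finset.add_sum_erase _ _ (Finset.mem_univ j)]
  exact le_add_of_nonneg_right <| Finset.sum_nonneg fun l hl =>
    mul_nonneg (hL j l (Finset.ne_of_mem_erase hl).symm) (hv l)

theorem strongLT_of_nonneg (hL : IsMetzler L) (hv : 0 ≤ v) (hLv : StrongLT (L *ᵥ v) 0) :
    StrongLT 0 v := by
  refine fun j => (hv j).lt_of_ne fun hj => ?_
  have := hL.diag_mul_le_mulVec hv j
  rw [← hj, Pi.zero_apply, mul_zero] at this
  exact this.not_gt (hLv j)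

theorem nonneg_of_rowSum_neg (hL : IsMetzler L) (hrow : ∀ j, ∑ l, L j l < 0)
    (hLv : StrongLT (L *ᵥ v) 0) : 0 ≤ v := by
  intro i
  obtain ⟨j, -, hj⟩ := Finset.exists_min_image Finset.univ v ⟨i, Finset.mem_univ i⟩
  refine le_trans ?_ (hj i (Finset.mem_univ i))
  by_contra! hneg
  have hmin : 0 ≤ v - fun _ => v j := fun l => sub_nonneg.2 (hj l (Finset.mem_univ l))
  have hle : (∑ l, L j l) * v j ≤ (L *ᵥ v) j := by
    have := hL.diag_mul_le_mulVec hmin j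
    rw [Matrix.mulVec_sub, Pi.sub_apply, sub_self, mul_zero, Pi.sub_apply, sub_nonneg] at this
    rwa [Finset.sum_mul]
  exact (hle.trans_lt (hLv j)).not_gt (mul_pos_of_neg_of_neg (hrow j) hneg)

end OrderedRing

section Real

variable {ι : Type*} [Fintype ι] [DecidableEq ι] {L : Matrix ι ι ℝ} {y : ι → ℝ}

/- The vector `v μ = -(L - μ)⁻¹ y` solves `(L - μ) v = -y ≺ 0`, so it is nonnegative only if it is
positive: the set of such `μ ≥ 0` is both closed and open, and it contains all large `μ`. -/
theorem strongLT_neg_inv_mulVec (hL : IsMetzler L)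
    (hunit : ∀ μ : ℝ, 0 ≤ μ → IsUnit (L - μ • (1 : Matrix ι ι ℝ))) (hy : StrongLT 0 y) :
    StrongLT 0 (-(L⁻¹ *ᵥ y)) := by
  let M (μ : Ici (0 : ℝ)) : Matrix ι ι ℝ := L - (μ : ℝ) • (1 : Matrix ι ι ℝ)
  let v (μ : Ici (0 : ℝ)) : ι → ℝ := -((M μ)⁻¹ *ᵥ y)
  have hdet (μ : Ici (0 : ℝ)) : IsUnit (M μ).det :=
    (Matrix.isUnit_iff_isUnit_det _).1 (hunit μ μ.2)
  have hMv (μ : Ici (0 : ℝ)) : StrongLT (M μ *ᵥ v μ) 0 := fun j => by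
    simpa [v, Matrix.mulVec_neg, Matrix.mul_nonsing_inv _ (hdet μ)] using hy j
  have hv_cont : Continuous v := by
    have hM : Continuous M := by fun_prop
    have hM_inv : Continuous fun μ => (M μ)⁻¹ := continuous_iff_continuousAt.2 fun μ =>
      (continuousAt_matrix_inv (M μ) (by
        simpa only [Ring.inverse_eq_inv'] using continuousAt_inv₀ (hdet μ).ne_zero)).comp
          hM.continuousAt
    exact (hM_inv.matrix_mulVec continuous_const).neg
  have hpos_iff (μ : Ici (0 : ℝ)) : StrongLT 0 (v μ) ↔ 0 ≤ v μ :=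
    ⟨fun h => h.le, fun h => (hL.sub_smul_one μ).strongLT_of_nonneg h (hMv μ)⟩
  have hclopen : IsClopen {μ | 0 ≤ v μ} := by
    refine ⟨isClosed_le continuous_const hv_cont, ?_⟩
    have hset : {μ | 0 ≤ v μ} = {μ | StrongLT (-v μ) 0} :=
      Set.ext fun μ => (hpos_iff μ).symm.trans (forall_congr' fun _ => neg_lt_zero.symm)
    exact hset ▸ (isOpen_setOf_strongLT 0).preimage hv_cont.neg
  have hlarge : {μ | 0 ≤ v μ}.Nonempty := by
    obtain ⟨C, hC⟩ := (finite_range fun j => ∑ l, L j l).bddAbove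
    refine ⟨⟨max 0 (C + 1), mem_Ici.2 (le_max_left _ _)⟩,
      (hL.sub_smul_one _).nonneg_of_rowSum_neg ?_ (hMv _)⟩
    intro j
    have hCj : ∑ l, L j l ≤ C := hC (mem_range_self j)
    simpa [Matrix.one_apply] using Or.inr (hCj.trans_lt (lt_add_one C))
  have : PreconnectedSpace (Ici (0 : ℝ)) := Subtype.preconnectedSpace isPreconnected_Ici
  have hzero : StrongLT 0 (v ⟨0, self_mem_Ici⟩) :=
    (hpos_iff _).2 (eq_univ_iff_forall.1 (hclopen.eq_univ hlarge) _)
  simpa [v, M] using hzero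

theorem neg_inv_mulVec_nonneg (hL : IsMetzler L)
    (hunit : ∀ μ : ℝ, 0 ≤ μ → IsUnit (L - μ • (1 : Matrix ι ι ℝ))) (hy : 0 ≤ y) :
    0 ≤ -(L⁻¹ *ᵥ y) := by
  have hcont : Continuous fun ε : ℝ => -(L⁻¹ *ᵥ (y + fun _ => ε)) :=
    (continuous_const.matrix_mulVec
      (continuous_const.add (continuous_pi fun _ => continuous_id))).neg
  have hlim : Tendsto (fun ε : ℝ => -(L⁻¹ *ᵥ (y + fun _ => ε))) (𝓝[>] 0) (𝓝 (-(L⁻¹ *ᵥ y))) := by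
    have hzero : y + (fun _ => (0 : ℝ)) = y := add_zero y
    simpa only [hzero] using (hcont.tendsto 0).mono_left nhdsWithin_le_nhds
  refine ge_of_tendsto hlim ?_
  filter_upwards [self_mem_nhdsWithin] with ε hε
  exact (hL.strongLT_neg_inv_mulVec hunit fun j => add_pos_of_nonneg_of_pos (hy j) hε).le

end Real

/- In `(r j) ^ 2`, unlike in `r j`, the modulus of a complex coordinate is differentiable also where
it vanishes. -/
theorem strongLT_of_ae_hasDerivAt_sq {ι : Type*} [Fintype ι] {L : Matrix ι ι ℝ}
    (hL : IsMetzler L) {c d : ι → ℝ} (hcd : StrongLT (L *ᵥ c + d) 0) {r : ℝ → ι → ℝ}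
    (hr : ∀ t, 0 ≤ r t)
    (hac : ∀ t, 0 ≤ t → ∀ j, AbsolutelyContinuousOnInterval (fun s => r s j) 0 t)
    (hderiv : ∀ᵐ t, 0 < t → (∀ s ∈ Icc 0 t, StrongLT (r s) c) → ∀ j,
      ∃ D ≤ 2 * r t j * ((L *ᵥ r t) j + d j), HasDerivAt (fun s => r s j ^ 2) D t)
    (h0 : StrongLT (r 0) c) {t : ℝ} (ht : 0 ≤ t) : StrongLT (r t) c := by
  by_contra hexit
  have hcont : ContinuousOn r (Icc 0 t) :=
    continuousOn_pi.2 fun j => uIcc_of_le ht ▸ (hac t ht j).continuousOn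
  obtain ⟨t₀, ht₀, ⟨j, hj⟩, hbefore⟩ := exists_first_exit ht hcont h0 hexit
  have hleft : Tendsto (fun s => r s j) (𝓝[<] t₀) (𝓝 (c j)) := by
    have := ((continuousOn_pi.1 hcont j) t₀ (Ioc_subset_Icc_self ht₀)).mono_of_mem_nhdsWithin
      (mem_of_superset (Ico_mem_nhdsLT ht₀.1) (Ico_subset_Icc_self.trans
        (Icc_subset_Icc_right ht₀.2)))
    simpa only [hj] using this.tendsto
  have hinward : ∀ᶠ s in 𝓝[<] t₀, (L *ᵥ c + d) j - L j j * (c j - r s j) < 0 := by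
    refine Tendsto.eventually_lt_const (hcd j) ?_
    simpa using (tendsto_const_nhds (x := (L *ᵥ c + d) j)).sub
      ((tendsto_const_nhds (x := c j)).sub hleft |>.const_mul (L j j))
  obtain ⟨t₁, ht₁, hnear⟩ := (mem_nhdsLT_iff_exists_Ico_subset).1
    (hinward.and (Ioo_mem_nhdsLT ht₀.1))
  have ht₁0 : 0 < t₁ := (hnear (left_mem_Ico.2 ht₁)).2.1
  have hsq_ac : AbsolutelyContinuousOnInterval (fun s => r s j ^ 2) t₁ t₀ := by
    have hrj := (hac t₀ ht₀.1.le j).mono (c := t₁) (d := t₀) (by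
      rw [uIcc_of_le ht₁.le, uIcc_of_le ht₀.1.le]
      exact Icc_subset_Icc_left ht₁0.le)
    simpa only [sq, smul_eq_mul] using hrj.fun_smul hrj
  have hle : r t₀ j ^ 2 ≤ r t₁ j ^ 2 := by
    refine le_of_ae_hasDerivAt_nonpos ht₁.le hsq_ac ?_
    filter_upwards [hderiv] with s hs hmem
    have hs0 : 0 < s := ht₁0.trans hmem.1
    obtain ⟨D, hD, hDs⟩ := hs hs0 (fun u hu => hbefore u ⟨hu.1, hu.2.trans_lt hmem.2⟩) j
    refine ⟨D, hD.trans (mul_nonpos_of_nonneg_of_nonpos (mul_nonneg zero_le_two (hr s j)) ?_), hDs⟩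
    have hdiag := hL.diag_mul_le_mulVec (sub_nonneg.2 (hbefore s ⟨hs0.le, hmem.2⟩).le) j
    have hneg := (hnear (Ioo_subset_Ico_self hmem)).1
    simp only [Matrix.mulVec_sub, Pi.sub_apply, Pi.add_apply] at hdiag hneg
    linarith
  exact hle.not_gt (hj ▸ pow_lt_pow_left₀ (hbefore t₁ ⟨ht₁0.le, ht₁⟩ j) (hr t₁ j) two_ne_zero)

end IsMetzler

end Metzler

section FixedPoint

variable {n : ℕ} {L : Matrix (Fin n) (Fin n) ℝ} {δ : (Fin n → ℝ) → (Fin n → ℝ)}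

theorem IsHurwitz.isUnit_sub_smul_one (hH : IsHurwitz L) {μ : ℝ} (hμ : 0 ≤ μ) :
    IsUnit (L - μ • (1 : Matrix (Fin n) (Fin n) ℝ)) := by
  have hμ_notMem : (μ : ℂ) ∉ spectrum ℂ (L.map Complex.ofReal) := fun h =>
    (hH _ h).not_ge (by simpa using hμ)
  have hmap : algebraMap ℂ (Matrix (Fin n) (Fin n) ℂ) (μ : ℂ) - L.map Complex.ofReal =
      -Complex.ofRealHom.mapMatrix (L - μ • (1 : Matrix (Fin n) (Fin n) ℝ)) := by
    ext i j
    by_cases hij : i = j <;> simp [Matrix.algebraMap_matrix_apply, hij]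
  rwa [spectrum.notMem_iff, hmap, IsUnit.neg_iff, Matrix.isUnit_iff_isUnit_det, ← RingHom.map_det,
    isUnit_map_iff, ← Matrix.isUnit_iff_isUnit_det] at hμ_notMem

theorem IsHurwitz.isUnit (hH : IsHurwitz L) : IsUnit L := by
  simpa using hH.isUnit_sub_smul_one le_rfl

theorem mulVec_T (hL : IsUnit L) (γ x : Fin n → ℝ) : L *ᵥ T L δ γ x = L *ᵥ γ - δ x := by
  rw [T, Matrix.mulVec_add, Matrix.mulVec_neg, Matrix.mulVec_mulVec,
    Matrix.mul_nonsing_inv _ ((Matrix.isUnit_iff_isUnit_det L).1 hL), Matrix.one_mulVec,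
    neg_add_eq_sub]

theorem continuousOn_T {s : Set (Fin n → ℝ)} (hδ : ContinuousOn δ s) (γ : Fin n → ℝ) :
    ContinuousOn (T L δ γ) s := by
  have : Continuous fun v : Fin n → ℝ => -(L⁻¹ *ᵥ v) + γ :=
    (continuous_const.matrix_mulVec continuous_id).neg.add continuous_const
  exact this.comp_continuousOn hδ

theorem monotoneOn_T (hL : IsMetzler L) (hH : IsHurwitz L) {s : Set (Fin n → ℝ)}
    (hδ : MonotoneOn δ s) (γ : Fin n → ℝ) : MonotoneOn (T L δ γ) s := fun x hx y hy hxy => by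
  have := hL.neg_inv_mulVec_nonneg (fun _ => hH.isUnit_sub_smul_one)
    (sub_nonneg.2 (hδ hx hy hxy))
  rw [Matrix.mulVec_sub, neg_sub, sub_nonneg] at this
  exact add_le_add_left (neg_le_neg this) γ

theorem exists_isFixedPt_T_tendsto_iterate (hL : IsMetzler L) (hH : IsHurwitz L)
    (hδ : IsContCNI δ) {β : Fin n → ℝ} (hβ : 0 ≤ β) (hTβ : T L δ 0 β ≤ β) :
    ∃ b, 0 ≤ b ∧ IsFixedPt (T L δ 0) b ∧ Tendsto (fun m : ℕ => (T L δ 0)^[m] β) atTop (𝓝 b) := by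
  have hT0 : 0 ≤ T L δ 0 0 := by
    simpa only [T, add_zero] using hL.neg_inv_mulVec_nonneg (fun _ => hH.isUnit_sub_smul_one)
      (hδ.mapsTo (self_mem_Ici (a := 0)))
  obtain ⟨b, hb, hfix, hlim⟩ := exists_isFixedPt_tendsto_iterate hβ
    ((monotoneOn_T hL hH hδ.monotoneOn 0).mono Icc_subset_Ici_self)
    ((continuousOn_T hδ.continuousOn 0).mono Icc_subset_Ici_self) hT0 hTβ
  exact ⟨b, hb.1, hfix, hlim⟩

theorem exists_strongLT_mulVec_add_strongLT_zero (hL : IsMetzler L) (hH : IsHurwitz L)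
    (hδ : MonotoneOn δ (Ici 0)) {a b : Fin n → ℝ} (hb : 0 ≤ b) (hba : b ≤ a)
    (hTb : b ≤ T L δ 0 b) (hTa : StrongLT (T L δ 0 a) a) :
    ∃ c, StrongLT b c ∧ c ≤ a ∧ StrongLT (L *ᵥ c + δ c) 0 := by
  let e : Fin n → ℝ := -(L⁻¹ *ᵥ 1)
  have he : StrongLT 0 e :=
    hL.strongLT_neg_inv_mulVec (fun _ => hH.isUnit_sub_smul_one) fun _ => zero_lt_one
  have hLe : L *ᵥ e = -1 := by
    simpa [T, e] using mulVec_T (δ := fun _ => 1) hH.isUnit 0 0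
  obtain ⟨r, hr, hca⟩ := exists_pos_add_smul_le hTa e
  have hbT : b ≤ T L δ 0 a := hTb.trans (monotoneOn_T hL hH hδ 0 hb (hb.trans hba) hba)
  have hbc : StrongLT b (T L δ 0 a + r • e) := fun j =>
    (hbT j).trans_lt (lt_add_of_pos_right _ (mul_pos hr (he j)))
  refine ⟨T L δ 0 a + r • e, hbc, hca, fun j => ?_⟩
  have hδc := hδ (hb.trans hbc.le) (hb.trans hba) hca j
  rw [Matrix.mulVec_add, mulVec_T hH.isUnit, Matrix.mulVec_zero, Matrix.mulVec_smul, hLe]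
  simp only [Pi.add_apply, Pi.sub_apply, Pi.smul_apply, Pi.neg_apply, Pi.zero_apply, Pi.one_apply,
    smul_eq_mul]
  linarith

end FixedPoint

section Lam

variable {N n : ℕ} (A : Fin N → Matrix (Fin n) (Fin n) ℝ) (V : Matrix (Fin n) (Fin n) ℂ)

theorem metzlerPart_le_Lam (i : Fin N) (j l : Fin n) :
    metzlerPart (V⁻¹ * (A i).map Complex.ofReal * V) j l ≤ Lam A V j l :=
  le_ciSup (f := fun i => metzlerPart (V⁻¹ * (A i).map Complex.ofReal * V) j l)
    (finite_range _).bddAbove i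

theorem isMetzler_Lam : IsMetzler (Lam A V) := fun j l hjl =>
  Real.iSup_nonneg fun i => by simp [metzlerPart, hjl]

end Lam

section Coordinates

theorem norm_mulVec_apply_le {ι κ R : Type*} [Fintype κ] [SeminormedRing R] (M : Matrix ι κ R)
    (z : κ → R) (j : ι) : ‖(M *ᵥ z) j‖ ≤ ∑ l, ‖M j l‖ * ‖z l‖ :=
  (norm_sum_le _ _).trans (Finset.sum_le_sum fun _ _ => norm_mul_le _ _)

variable {n : ℕ}

theorem inner_mulVec_apply_le (M : Matrix (Fin n) (Fin n) ℂ) (z : Fin n → ℂ) (j : Fin n) :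
    inner ℝ (z j) ((M *ᵥ z) j) ≤ ‖z j‖ * (metzlerPart M *ᵥ fun l => ‖z l‖) j := by
  simp only [Matrix.mulVec, dotProduct, inner_sum, Finset.mul_sum]
  refine Finset.sum_le_sum fun l _ => ?_
  by_cases hjl : j = l
  · subst hjl
    have hnorm : ‖z j‖ * ‖z j‖ = (z j).re * (z j).re + (z j).im * (z j).im := by
      rw [← sq, Complex.sq_norm, Complex.normSq_apply]
    simp only [metzlerPart, Matrix.of_apply, if_true, Complex.inner, Complex.mul_re,
      Complex.mul_im, Complex.conj_re, Complex.conj_im]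
    linear_combination -(M j j).re * hnorm
  · refine (real_inner_le_norm _ _).trans_eq ?_
    simp only [metzlerPart, Matrix.of_apply, if_neg hjl, norm_mul]

/-- The coordinates `z = V⁻¹ x` of a real vector `x`, as a real-linear map, so that
`absCoord V x = |z|`. -/
noncomputable def coord (V : Matrix (Fin n) (Fin n) ℂ) : (Fin n → ℝ) →L[ℝ] (Fin n → ℂ) :=
  LinearMap.toContinuousLinearMap
    (V⁻¹.mulVecLin.restrictScalars ℝ ∘ₗ (Algebra.linearMap ℝ ℂ).compLeft (Fin n))

variable {V : Matrix (Fin n) (Fin n) ℂ}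

theorem absCoord_apply (x : Fin n → ℝ) (j : Fin n) : absCoord V x j = ‖coord V x j‖ := rfl

theorem absCoord_nonneg (x : Fin n → ℝ) : 0 ≤ absCoord V x := fun _ => norm_nonneg _

theorem lipschitzWith_absCoord_apply (V : Matrix (Fin n) (Fin n) ℂ) (j : Fin n) :
    LipschitzWith ‖coord V‖₊ fun x => absCoord V x j := by
  have := lipschitzWith_one_norm.comp ((LipschitzWith.eval j).comp (coord V).lipschitz)
  rwa [one_mul, one_mul] at this

theorem mulVec_coord (hV : IsUnit V) (x : Fin n → ℝ) : V *ᵥ coord V x = Complex.ofReal ∘ x := by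
  change V *ᵥ (V⁻¹ *ᵥ (Complex.ofReal ∘ x)) = _
  rw [Matrix.mulVec_mulVec, Matrix.mul_nonsing_inv _ ((Matrix.isUnit_iff_isUnit_det V).1 hV),
    Matrix.one_mulVec]

theorem coord_mulVec (hV : IsUnit V) (M : Matrix (Fin n) (Fin n) ℝ) (x : Fin n → ℝ) :
    coord V (M *ᵥ x) = (V⁻¹ * M.map Complex.ofReal * V) *ᵥ coord V x := by
  rw [← Matrix.mulVec_mulVec, mulVec_coord hV, ← Matrix.mulVec_mulVec]
  exact congrArg (V⁻¹ *ᵥ ·) (funext fun l => RingHom.map_mulVec Complex.ofRealHom M x l)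

theorem abs_le_absMatrix_mulVec (hV : IsUnit V) {x c : Fin n → ℝ} (hx : absCoord V x ≤ c)
    (j : Fin n) : |x j| ≤ (absMatrix V *ᵥ c) j :=
  calc |x j| = ‖(V *ᵥ coord V x) j‖ := by
        rw [mulVec_coord hV, Function.comp_apply, Complex.norm_real, Real.norm_eq_abs]
    _ ≤ ∑ l, ‖V j l‖ * ‖coord V x l‖ := norm_mulVec_apply_le _ _ _
    _ ≤ ∑ l, ‖V j l‖ * c l :=
        Finset.sum_le_sum fun l _ => mul_le_mul_of_nonneg_left (hx l) (norm_nonneg _)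

theorem absMatrix_mulVec_nonneg {c : Fin n → ℝ} (hc : 0 ≤ c) : 0 ≤ absMatrix V *ᵥ c :=
  fun j => dotProduct_nonneg_of_nonneg (fun l => norm_nonneg (V j l)) hc

theorem absCoord_le_psi {N : ℕ} {k : Fin N → ℕ} (H : ∀ i, Matrix (Fin n) (Fin (k i)) ℝ)
    (δw : ∀ i, (Fin n → ℝ) → (Fin (k i) → ℝ)) (x : Fin n → ℝ) (i : Fin N) {w : Fin (k i) → ℝ}
    (hw : ∀ l, |w l| ≤ δw i (absMatrix V *ᵥ x) l) :
    absCoord V (H i *ᵥ w) ≤ psi H δw V x := by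
  intro j
  let box : Set (Fin (k i) → ℝ) := {w | ∀ l, |w l| ≤ δw i (absMatrix V *ᵥ x) l}
  have hbox : box = Icc (-δw i (absMatrix V *ᵥ x)) (δw i (absMatrix V *ᵥ x)) := by
    ext w
    simp [box, abs_le, Pi.le_def, forall_and]
  have hcont : Continuous fun w : Fin (k i) → ℝ => absCoord V (H i *ᵥ w) j :=
    (lipschitzWith_absCoord_apply V j).continuous.comp
      (continuous_const.matrix_mulVec continuous_id)
  have hbdd : BddAbove ((fun w => absCoord V (H i *ᵥ w) j) '' box) :=
    ((hbox ▸ isCompact_Icc).image hcont).bddAbove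
  exact (le_csSup hbdd (mem_image_of_mem _ hw)).trans
    (le_ciSup (f := fun i => sSup ((fun w : Fin (k i) → ℝ => absCoord V (H i *ᵥ w) j) ''
      {w | ∀ l, |w l| ≤ δw i (absMatrix V *ᵥ x) l})) (finite_range _).bddAbove i)

theorem exists_hasDerivAt_sq_absCoord_le {N : ℕ} (A : Fin N → Matrix (Fin n) (Fin n) ℝ)
    (hV : IsUnit V) (i : Fin N) {x : ℝ → Fin n → ℝ} {u : Fin n → ℝ} {t : ℝ}
    (hx : HasDerivAt x (A i *ᵥ x t + u) t) (j : Fin n) :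
    ∃ D ≤ 2 * absCoord V (x t) j * ((Lam A V *ᵥ absCoord V (x t)) j + absCoord V u j),
      HasDerivAt (fun s => absCoord V (x s) j ^ 2) D t := by
  let M : Matrix (Fin n) (Fin n) ℂ := V⁻¹ * (A i).map Complex.ofReal * V
  let z : Fin n → ℂ := coord V (x t)
  have hz : HasDerivAt (fun s => coord V (x s) j) ((M *ᵥ z) j + coord V u j) t := by
    have := hasDerivAt_pi.1 ((coord V).hasFDerivAt.comp_hasDerivAt t hx) j
    rwa [map_add, coord_mulVec hV] at this
  refine ⟨_, ?_, hz.norm_sq⟩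
  have hLam : (metzlerPart M *ᵥ absCoord V (x t)) j ≤ (Lam A V *ᵥ absCoord V (x t)) j :=
    dotProduct_le_dotProduct_of_nonneg_right (metzlerPart_le_Lam A V i j) (absCoord_nonneg _)
  have hlinear : inner ℝ (z j) ((M *ᵥ z) j) ≤ ‖z j‖ * (Lam A V *ᵥ absCoord V (x t)) j :=
    (inner_mulVec_apply_le M z j).trans (mul_le_mul_of_nonneg_left hLam (norm_nonneg _))
  have hinput : inner ℝ (z j) (coord V u j) ≤ ‖z j‖ * absCoord V u j := real_inner_le_norm _ _
  rw [inner_add_right, absCoord_apply (x t) j]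
  linarith

end Coordinates

section Trajectory

variable {N n : ℕ} {k : Fin N → ℕ} {A : Fin N → Matrix (Fin n) (Fin n) ℝ}
  {H : ∀ i, Matrix (Fin n) (Fin (k i)) ℝ} {δw : ∀ i, (Fin n → ℝ) → (Fin (k i) → ℝ)} {τ : ℝ}
  {V : Matrix (Fin n) (Fin n) ℂ} {σ : ℝ → Fin N} {w : ∀ i, ℝ → Fin (k i) → ℝ}
  {x : ℝ → Fin n → ℝ} {c : Fin n → ℝ} {t : ℝ}

theorem theta_nonneg : 0 ≤ theta τ x t := fun _ =>
  Real.sSup_nonneg (forall_mem_image.2 fun _ _ => abs_nonneg _)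

theorem theta_le_absMatrix_mulVec (hV : IsUnit V) (hc : 0 ≤ c)
    (hpast : ∀ s ∈ Icc (t - τ) t, absCoord V (x s) ≤ c) : theta τ x t ≤ absMatrix V *ᵥ c :=
  fun j => Real.sSup_le
    (forall_mem_image.2 fun s hs => abs_le_absMatrix_mulVec hV (hpast s hs) j)
    (absMatrix_mulVec_nonneg hc j)

namespace IsTrajectory

theorem absCoord_input_le_psi (hx : IsTrajectory A H δw τ σ w x)
    (hδw : ∀ i, MonotoneOn (δw i) (Ici 0)) (hV : IsUnit V) (hc : 0 ≤ c) (ht : 0 ≤ t)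
    (hpast : ∀ s ∈ Icc (t - τ) t, absCoord V (x s) ≤ c) :
    absCoord V (H (σ t) *ᵥ w (σ t) t) ≤ psi H δw V c :=
  absCoord_le_psi H δw c (σ t) fun l => (hx.bound t ht (σ t) l).trans <|
    hδw (σ t) theta_nonneg (absMatrix_mulVec_nonneg hc) (theta_le_absMatrix_mulVec hV hc hpast) l

theorem absCoord_strongLT (hx : IsTrajectory A H δw τ σ w x)
    (hδw : ∀ i, MonotoneOn (δw i) (Ici 0)) (hτ : 0 ≤ τ) (hV : IsUnit V)
    (hsuper : StrongLT (Lam A V *ᵥ c + psi H δw V c) 0)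
    (hinit : ∀ s ∈ Icc (-τ) 0, StrongLT (absCoord V (x s)) c) (ht : -τ ≤ t) :
    StrongLT (absCoord V (x t)) c := by
  rcases le_total t 0 with ht0 | ht0
  · exact hinit t ⟨ht, ht0⟩
  have hstart : StrongLT (absCoord V (x 0)) c := hinit 0 ⟨neg_nonpos.2 hτ, le_rfl⟩
  refine (isMetzler_Lam A V).strongLT_of_ae_hasDerivAt_sq hsuper
    (r := fun s => absCoord V (x s)) (fun _ => absCoord_nonneg _) (fun s hs j =>
      absolutelyContinuousOnInterval_lipschitz_comp (lipschitzWith_absCoord_apply V j)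
        (hx.absolutelyContinuous s hs)) ?_ hstart ht0
  filter_upwards [(ae_restrict_iff' measurableSet_Ici).1 hx.hasDerivAt] with s hs hs0 hbox j
  have hpast : ∀ u ∈ Icc (s - τ) s, absCoord V (x u) ≤ c := fun u hu =>
    (le_total u 0).elim (fun hu0 => (hinit u ⟨by linarith [hu.1], hu0⟩).le)
      fun hu0 => (hbox u ⟨hu0, hu.2⟩).le
  have hinput := hx.absCoord_input_le_psi hδw hV ((absCoord_nonneg _).trans hstart.le) hs0.le hpast
  obtain ⟨D, hD, hDs⟩ := exists_hasDerivAt_sq_absCoord_le A hV (σ s) (hs hs0.le) j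
  refine ⟨D, hD.trans (mul_le_mul_of_nonneg_left (add_le_add_right (hinput j) _) ?_), hDs⟩
  exact mul_nonneg zero_le_two (absCoord_nonneg _ j)

end IsTrajectory

end Trajectory

end SwitchingSystem

open SwitchingSystem in
theorem mainTheorem6_general {N n : ℕ} {k : Fin N → ℕ}
    (A : Fin N → Matrix (Fin n) (Fin n) ℝ)
    (H : ∀ i, Matrix (Fin n) (Fin (k i)) ℝ)
    (δw : ∀ i, (Fin n → ℝ) → (Fin (k i) → ℝ))
    (hδw : ∀ i, MonotoneOn (δw i) (Ici 0))
    (τ : ℝ) (hτ : 0 ≤ τ)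
    (V : Matrix (Fin n) (Fin n) ℂ) (hV : IsUnit V)
    (hΛ : IsHurwitz (Lam A V))
    (δ : (Fin n → ℝ) → (Fin n → ℝ)) (hδ : IsContCNI δ)
    (hδψ : ∀ x, 0 ≤ x → psi H δw V x ≤ δ x)
    (β : Fin n → ℝ) (hβ : 0 ≤ β)
    (hTβ : StrongLT (T (Lam A V) δ 0 β) β) :
    ∃ b : Fin n → ℝ, 0 ≤ b ∧
      Tendsto (fun m : ℕ => (T (Lam A V) δ 0)^[m] β)
        atTop (𝓝 b) ∧
      ((∀ ε : Fin n → ℝ, StrongLT 0 ε → ∃ βε : Fin n → ℝ, b ≤ βε ∧ βε ≤ b + ε ∧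
          StrongLT (T (Lam A V) δ 0 βε) βε) →
        ∀ (σ : ℝ → Fin N) (w : ∀ i, ℝ → Fin (k i) → ℝ) (x : ℝ → Fin n → ℝ),
          IsTrajectory A H δw τ σ w x →
          (∀ t ∈ Icc (-τ) 0, absCoord V (x t) ≤ b) →
          ∀ t, -τ ≤ t → absCoord V (x t) ≤ b) := by
  have hMetzler := isMetzler_Lam A V
  obtain ⟨b, hb, hTb, hlim⟩ := exists_isFixedPt_T_tendsto_iterate hMetzler hΛ hδ hβ hTβ.le
  refine ⟨b, hb, hlim, fun happrox σ w x hx hinit t ht j => le_of_forall_pos_le_add fun ε hε => ?_⟩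
  obtain ⟨a, hba, haε, hTa⟩ := happrox (fun _ => ε) fun _ => hε
  obtain ⟨c, hbc, hca, hneg⟩ :=
    exists_strongLT_mulVec_add_strongLT_zero hMetzler hΛ hδ.monotoneOn hb hba hTb.ge hTa
  have hsuper : StrongLT (Lam A V *ᵥ c + psi H δw V c) 0 :=
    (add_le_add_right (hδψ c (hb.trans hbc.le)) _).trans_strongLT hneg
  have hbox : StrongLT (absCoord V (x t)) c :=
    hx.absCoord_strongLT hδw hτ hV hsuper (fun s hs => (hinit s hs).trans_strongLT hbc) ht
  exact (hbox.le.trans (hca.trans haε)) j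

theorem mainTheorem6 {N n : ℕ} [NeZero N] {k : Fin N → ℕ}
    (A : Fin N → Matrix (Fin n) (Fin n) ℝ)
    (H : ∀ i, Matrix (Fin n) (Fin (k i)) ℝ)
    (δw : ∀ i, (Fin n → ℝ) → (Fin (k i) → ℝ))
    (hδw : ∀ i, SwitchingSystem.IsContCNI (δw i))
    (τ : ℝ) (hτ : 0 ≤ τ)
    (V : Matrix (Fin n) (Fin n) ℂ) (hV : IsUnit V)
    (hΛ : SwitchingSystem.IsHurwitz (SwitchingSystem.Lam A V))
    (δ : (Fin n → ℝ) → (Fin n → ℝ)) (hδ : SwitchingSystem.IsContCNI δ)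
    (hδψ : ∀ x, 0 ≤ x → SwitchingSystem.psi H δw V x ≤ δ x)
    (β : Fin n → ℝ) (hβ : 0 ≤ β)
    (hTβ : StrongLT (SwitchingSystem.T (SwitchingSystem.Lam A V) δ 0 β) β) :
    ∃ b : Fin n → ℝ, 0 ≤ b ∧
      Tendsto (fun m : ℕ => (SwitchingSystem.T (SwitchingSystem.Lam A V) δ 0)^[m] β)
        atTop (𝓝 b) ∧
      ((∀ ε : Fin n → ℝ, StrongLT 0 ε → ∃ βε : Fin n → ℝ, b ≤ βε ∧ βε ≤ b + ε ∧
          StrongLT (SwitchingSystem.T (SwitchingSystem.Lam A V) δ 0 βε) βε) →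
        ∀ (σ : ℝ → Fin N) (w : ∀ i, ℝ → Fin (k i) → ℝ) (x : ℝ → Fin n → ℝ),
          SwitchingSystem.IsTrajectory A H δw τ σ w x →
          (∀ t ∈ Icc (-τ) 0, SwitchingSystem.absCoord V (x t) ≤ b) →
          ∀ t, -τ ≤ t → SwitchingSystem.absCoord V (x t) ≤ b) :=
  mainTheorem6_general A H δw (fun i => (hδw i).monotoneOn) τ hτ V hV hΛ δ hδ hδψ β hβ hTβ
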